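/- Let $X\subset\mathbb R^d$ be a compact convex set, let $\|\cdot\|$ be a norm on $\mathbb R^d$ with dual norm $\|\cdot\|_*$, and let $\psi$ be a differentiable function on $X$ that is $1$-strongly convex with respect to $\|\cdot\|$. Let $D(x,y)=\psi(x)-\psi(y)-\langle\nabla\psi(y),x-y\rangle$ and suppose that $D(x,y)\le\frac12R^2$ for all $x,y\in X$, for some $R<\infty$. Let $\Pi$ be a probability distribution on a measurable space $\Xi$, let $F(\cdot;\xi)$, $\xi\in\Xi$, be finite convex functions on $X$, with $F(x;\cdot)$ measurable and $\Pi$-integrable for each $x\in X$, let $f(x)=\mathbb E_\Pi[F(x;\xi)]$, and let $\mathsf G(x;\xi)\in\partial F(x;\xi)$ be a measurable selection of subgradients. Let $\xi_1,\xi_2,\dots$ be a stochastic process in $\Xi$ with law $P$, let $\mathcal F_s=\sigma(\xi_1,\dots,\xi_s)$, and let $P^t_{[s]}$ be a regular conditional distribution of $\xi_t$ given $\mathcal F_s$. For a distance $d$ between probability distributions and $\epsilon>0$ let $\tau_d(P_{[s]},\epsilon)$ be the smallest integer $n\ge1$ such that $d(P^t_{[s]},\Pi)\le\epsilon$ for all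 $t\ge s+n$ ($\infty$ if there is none). Suppose that the process is uniformly mixing: for $d$ the total variation distance $\int|p-q|\,d\mu$ and for $d$ the Hellinger distance $(\int(\sqrt p-\sqrt q)^2d\mu)^{1/2}$ there are finite deterministic numbers $\tau_d(P,\epsilon)$ such that, with probability $1$, $\tau_d(P_{[s]},\epsilon)\le\tau_d(P,\epsilon)$ for all $\epsilon>0$ and all $s$. Suppose also that there is a constant $L<\infty$ such that, for $\Pi$-almost every $\xi$ and, for each $t\ge1$, for almost every $\xi$ under the law of $\xi_t$, the function $F(\cdot;\xi)$ is $L$-Lipschitz on $X$ with respect to $\|\cdot\|$ and $\|\mathsf G(x;\xi)\|_*\le L$ for all $x\in X$. Let $\alpha>0$ and $\alpha(t)=\alpha/\sqrt t$, let $x(1)\in X$ be arbitrary, and for $t\ge1$ let $$x(t+1)=\operatorname*{argmin}_{x\in X}\Big\{\langle \mathsf G(x(t);\xi_t),x\rangle+\frac1{\alpha(t)}D(x,x(t))\Big\},\qquad \hat x(T)=\frac1T\sum_{t=1}^Tx(t).$$ Let $x^\star$ be a minimizer of $f$ over $X$. Then, as $T\to\infty$, $f(\hat x(T))\to f(x^\star)$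 both in expectation, that is, $f(\hat x(T))$ is integrable for every $T\ge 1$ and $\mathbb E[f(\hat x(T))]\to f(x^\star)$, and with probability $1$. -/

import Mathlib

open MeasureTheory ProbabilityTheory Filter Topology
open scoped NNReal ENNReal

namespace ErgodicMD

noncomputable section

/-! ### Mirror descent -/

section MirrorDescent

variable {E : Type*} [NormedAddCommGroup E] [NormedSpace ℝ E]

/-- `g` is a subgradient at `x` of the function `h`, regarded as a function on the set `X`
(equivalently, a subgradient of `h` plus the convex indicator of `X`). If `h` is the restriction
to `X` of a convex function with a larger domain, then every subgradient of that function at `x`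
is one in this sense. -/
def IsSubgradientOn (X : Set E) (h : E → ℝ) (x : E) (g : StrongDual ℝ E) : Prop :=
  ∀ y ∈ X, h x + g (y - x) ≤ h y

/-- The Bregman divergence `ψ x - ψ y - ⟨∇ψ(y), x - y⟩` of a function `ψ` differentiable on the
convex set `X`. For `x, y ∈ X` the last term is determined by the values of `ψ` on `X`, since
`x - y` is a direction tangent to `X` at `y`. -/
def bregman (X : Set E) (ψ : E → ℝ) (x y : E) : ℝ :=
  ψ x - ψ y - fderivWithin ℝ ψ X y (x - y)

/-- `x` is the sequence of iterates `x 1, x 2, …` of ergodic mirror descent on the samples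
`ξ 1, ξ 2, …`, started from the point `x₁`, with subgradient selection `G` and stepsizes `α`:
`x (t + 1)` minimizes `⟨G (x t) (ξ t), y⟩ + bregman y (x t) / α t` over `y ∈ X`. -/
structure IsEMD {Ω Ξ : Type*} (X : Set E) (ψ : E → ℝ) (G : E → Ξ → StrongDual ℝ E)
    (ξ : ℕ → Ω → Ξ) (α : ℕ → ℝ) (x₁ : E) (x : ℕ → Ω → E) : Prop where
  init : ∀ ω, x 1 ω = x₁
  mem : ∀ t, 1 ≤ t → ∀ ω, x (t + 1) ω ∈ X
  argmin : ∀ t, 1 ≤ t → ∀ ω,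
    IsMinOn (fun y => G (x t ω) (ξ t ω) y + (1 / α t) * bregman X ψ y (x t ω)) X (x (t + 1) ω)

/-- The average `(1 / T) ∑_{t = 1}^T x t`. -/
def average {Ω : Type*} (x : ℕ → Ω → E) (T : ℕ) (ω : Ω) : E :=
  (1 / (T : ℝ)) • ∑ t ∈ Finset.Icc 1 T, x t ω

/-- The objective `f(x) = E_ν[F(x; ·)]`. -/
def objective {Ξ : Type*} [MeasurableSpace Ξ] (F : E → Ξ → ℝ) (ν : Measure Ξ) (x : E) : ℝ :=
  ∫ z, F x z ∂ν

end MirrorDescent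

/-! ### Distances between probability distributions -/

section Distances

variable {Ξ : Type*} [MeasurableSpace Ξ]

/-- Total variation distance `∫ |p - q| dμ`, for the dominating measure `μ = P + Q`. -/
def tvDist (P Q : Measure Ξ) : ℝ :=
  ∫ z, |(P.rnDeriv (P + Q) z).toReal - (Q.rnDeriv (P + Q) z).toReal| ∂(P + Q)

/-- Hellinger distance `(∫ (√p - √q)² dμ)^{1/2}`, for the dominating measure `μ = P + Q`. -/
def hellingerDist (P Q : Measure Ξ) : ℝ :=
  √(∫ z, (√(P.rnDeriv (P + Q) z).toReal - √(Q.rnDeriv (P + Q) z).toReal) ^ 2 ∂(P + Q))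

end Distances

/-! ### Mixing -/

section Mixing

variable {Ω Ξ : Type*} [MeasurableSpace Ω] [MeasurableSpace Ξ]

/-- The σ-field `σ(ξ 1, …, ξ s)` of the first `s` samples. -/
abbrev pastSigma (ξ : ℕ → Ω → Ξ) (s : ℕ) : MeasurableSpace Ω :=
  ⨆ i ∈ Finset.Icc 1 s, MeasurableSpace.comap (ξ i) inferInstance

/-- `κ` is a (regular) conditional distribution of `Y` given the σ-field `m`. -/
structure IsCondLaw (P : Measure Ω) (m : MeasurableSpace Ω) (Y : Ω → Ξ) (κ : Ω → Measure Ξ) :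
    Prop where
  measurable : Measurable[m] κ
  prob : ∀ ω, IsProbabilityMeasure (κ ω)
  condProb : ∀ A, MeasurableSet A → (fun ω => (κ ω).real A) =ᵐ[P] P⟦Y ⁻¹' A | m⟧

/-- For a distance `d`, a target distribution `ν`, and the sequence `ρ t` of distributions of the
samples given the first `s` samples: the number of additional steps required until the
distribution is (and remains) within `ε` of `ν`; it is `⊤` if this never happens. -/
def mixingTime (d : Measure Ξ → Measure Ξ → ℝ) (ν : Measure Ξ) (ρ : ℕ → Measure Ξ) (s : ℕ)
    (ε : ℝ) : ℕ∞ :=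
  sInf {N : ℕ∞ | ∃ n : ℕ, N = n ∧ 1 ≤ n ∧ ∀ t, s + n ≤ t → d (ρ t) ν ≤ ε}

/-- The process `ξ 1, ξ 2, …` is uniformly mixing with limit distribution `ν`: with `κ s t` the
distribution of `ξ t` given the first `s` samples, there are finite (deterministic) uniform mixing
times `τtv ε`, `τhel ε` that almost surely bound the conditional mixing times in total variation
and in Hellinger distance, for all `ε > 0` and all `s`. -/
def UniformlyMixing (P : Measure Ω) (ξ : ℕ → Ω → Ξ) (ν : Measure Ξ) : Prop :=
  ∃ κ : ℕ → ℕ → Ω → Measure Ξ,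
    (∀ s t, s < t → IsCondLaw P (pastSigma ξ s) (ξ t) (κ s t)) ∧
    ∃ τtv τhel : ℝ → ℕ, ∀ᵐ ω ∂P, ∀ ε, 0 < ε → ∀ s,
      mixingTime tvDist ν (fun t => κ s t ω) s ε ≤ τtv ε ∧
      mixingTime hellingerDist ν (fun t => κ s t ω) s ε ≤ τhel ε

end Mixing

end

end ErgodicMD

/-! Mirror descent has a deterministic regret bound: for any sample path, the average of F(x(t);ξ_t)
- F(x⋆;ξ_t) is at most a quantity of order 1/√T (`mirror_descent_regret`). The difficulty is that
x(t) and ξ_t are dependent, so these losses are not f in expectation. The remedy is to test an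
iterate on a later sample. The iterate x(n+1) depends only on ξ_1, …, ξ_n, and by mixing in total
variation the conditional law of ξ_{n+τ} given this past is ε-close to Π. Hence f(x(n+1)) - f(x⋆) is
within Cε of the conditional mean of the excess loss of x(n+1) at ξ_{n+τ}, where C bounds that
excess loss. Two errors remain. Replacing the conditional mean by the loss itself leaves bounded
variables orthogonal at distance τ, whose averages vanish almost surely
(`ae_tendsto_average_centred`). Replacing x(n+1) by x(n+τ) costs O(τ/√n), because a single step
moves by at most Lα(t) (`mirror_descent_stable`). `tendsto_average_of_shifted` assembles these
estimates pathwise. Jensen's inequality then passes to the averaged iterate, and dominated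
convergence gives the statement in expectation. -/

namespace ErgodicMD

/-! ### Inequalities for one mirror step -/

section MirrorStep

variable {E : Type*} [NormedAddCommGroup E] [NormedSpace ℝ E]

/-- When X has empty interior the derivative within X is not unique, but along x - y it is forced by
the values of ψ on the segment. Writing it as a limit of a sequence also gives measurability in y
without continuity of the gradient. -/
lemma tendsto_slope_fderivWithin {X : Set E} (hX : Convex ℝ X) {ψ : E → ℝ}
    (hψ : DifferentiableOn ℝ ψ X) {x y : E} (hx : x ∈ X) (hy : y ∈ X) :
    Tendsto (fun n : ℕ => ((n : ℝ) + 1) *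
      (ψ (y + (1 / ((n : ℝ) + 1)) • (x - y)) - ψ y)) atTop
      (𝓝 (fderivWithin ℝ ψ X y (x - y))) := by
  have h := (hψ y hy).hasFDerivWithinAt
  refine h.lim (l := atTop) (c := fun n : ℕ => (n : ℝ) + 1)
    (d := fun n : ℕ => (1 / ((n : ℝ) + 1)) • (x - y)) ?_ ?_ ?_
  · simpa using (tendsto_one_div_add_atTop_nhds_zero_nat (𝕜 := ℝ)).smul_const (x - y)
  · refine Eventually.of_forall fun n => ?_
    have hn : (0 : ℝ) < (n : ℝ) + 1 := by positivity
    refine hX.add_smul_sub_mem hy hx ⟨by positivity, ?_⟩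
    rw [div_le_one hn]; linarith [(Nat.cast_nonneg n : (0 : ℝ) ≤ n)]
  · refine tendsto_const_nhds.congr fun n => ?_
    have hn : (n : ℝ) + 1 ≠ 0 := by positivity
    rw [smul_smul, mul_one_div_cancel hn, one_smul]

/-- Strong convexity at weight 1/(n+1) on x, multiplied by n+1, bounds the difference quotients from
above; then n → ∞. -/
lemma half_sq_le_bregman {X : Set E} {ψ : E → ℝ}
    (hψ : DifferentiableOn ℝ ψ X) (hsc : StrongConvexOn X 1 ψ) {x y : E}
    (hx : x ∈ X) (hy : y ∈ X) : 1 / 2 * ‖x - y‖ ^ 2 ≤ bregman X ψ x y := by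
  have h1 := tendsto_slope_fderivWithin hsc.1 hψ hx hy
  have h2 : Tendsto (fun n : ℕ => ψ x - ψ y - (1 - 1 / ((n : ℝ) + 1)) * (1 / 2 * ‖x - y‖ ^ 2))
      atTop (𝓝 (ψ x - ψ y - (1 - 0) * (1 / 2 * ‖x - y‖ ^ 2))) :=
    tendsto_const_nhds.sub
      ((tendsto_const_nhds.sub tendsto_one_div_add_atTop_nhds_zero_nat).mul_const _)
  have h3 := le_of_tendsto_of_tendsto' h1 h2 fun n => by
    have hn : (0 : ℝ) < (n : ℝ) + 1 := by positivity
    have hn1 : 1 / ((n : ℝ) + 1) ≤ 1 := by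
      rw [div_le_one hn]; linarith [(Nat.cast_nonneg n : (0 : ℝ) ≤ n)]
    have hc := hsc.2 hx hy (by positivity : 0 ≤ 1 / ((n : ℝ) + 1))
      (by linarith : 0 ≤ 1 - 1 / ((n : ℝ) + 1)) (by ring)
    have he : (1 / ((n : ℝ) + 1)) • x + (1 - 1 / ((n : ℝ) + 1)) • y
        = y + (1 / ((n : ℝ) + 1)) • (x - y) := by
      rw [smul_sub, sub_smul, one_smul]; abel
    rw [he] at hc
    simp only [smul_eq_mul] at hc
    have := mul_le_mul_of_nonneg_left hc hn.le
    have e : ((n : ℝ) + 1) * (1 / ((n : ℝ) + 1)) = 1 := mul_one_div_cancel hn.ne'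
    calc _ = ((n : ℝ) + 1) * ψ (y + (1 / ((n : ℝ) + 1)) • (x - y)) - ((n : ℝ) + 1) * ψ y := by ring
      _ ≤ _ := sub_le_sub_right this _
      _ = _ := by linear_combination (ψ x - ψ y - (1 - 1 / ((n : ℝ) + 1)) * (1 / 2 * ‖x - y‖ ^ 2)) * e
  unfold bregman
  linarith

lemma bregman_self (X : Set E) (ψ : E → ℝ) (x : E) : bregman X ψ x x = 0 := by
  simp [bregman]

/-- First-order optimality of a mirror step, combined with the three-point identity. -/
lemma mirror_step_three_point {X : Set E} (hX : Convex ℝ X) {ψ : E → ℝ}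
    (hψ : DifferentiableOn ℝ ψ X) {g : StrongDual ℝ E} {c : ℝ} {u v : E} (hv : v ∈ X)
    (hmin : IsMinOn (fun y => g y + c * bregman X ψ y u) X v) {y : E} (hy : y ∈ X) :
    g (v - y) ≤ c * (bregman X ψ y u - bregman X ψ y v - bregman X ψ v u) := by
  have hd : HasFDerivWithinAt (fun y => g y + c * bregman X ψ y u)
      (g + c • (fderivWithin ℝ ψ X v - fderivWithin ℝ ψ X u)) X v := by
    unfold bregman
    refine g.hasFDerivWithinAt.add (HasFDerivWithinAt.const_mul ?_ c)
    refine ((hψ v hv).hasFDerivWithinAt.sub_const _).sub ?_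
    exact ((fderivWithin ℝ ψ X u).hasFDerivWithinAt).comp v
      ((hasFDerivWithinAt_id v X).sub_const u) (Set.mapsTo_univ _ _)
  have h := hmin.localize.hasFDerivWithinAt_nonneg hd
    (sub_mem_posTangentConeAt_of_segment_subset (hX.segment_subset hv hy))
  simp only [add_apply, smul_apply,
    sub_apply, smul_eq_mul] at h
  have e1 : y - u = (y - v) + (v - u) := by abel
  have e2 : v - y = -(y - v) := by abel
  unfold bregman
  rw [e1, e2, map_neg, map_add]
  linarith

/-- Quadratic growth forces approximate minimizers to be near the minimizer, which is what makes the
step measurable. -/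
lemma mirror_step_growth {X : Set E} {ψ : E → ℝ}
    (hψ : DifferentiableOn ℝ ψ X) (hsc : StrongConvexOn X 1 ψ) {g : StrongDual ℝ E} {c : ℝ}
    (hc : 0 ≤ c) {u v : E} (hv : v ∈ X)
    (hmin : IsMinOn (fun y => g y + c * bregman X ψ y u) X v) {y : E} (hy : y ∈ X) :
    c * (1 / 2 * ‖y - v‖ ^ 2) ≤
      (g y + c * bregman X ψ y u) - (g v + c * bregman X ψ v u) := by
  have h := mirror_step_three_point hsc.1 hψ hv hmin hy
  have h2 := mul_le_mul_of_nonneg_left (half_sq_le_bregman hψ hsc hy hv) hc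
  rw [map_sub] at h
  linarith

/-- Testing optimality against the starting point u produces both D(u,v) and D(v,u), so ‖v - u‖²/a ≤
g(u - v) ≤ L‖v - u‖. -/
lemma mirror_step_stable {X : Set E} {ψ : E → ℝ}
    (hψ : DifferentiableOn ℝ ψ X) (hsc : StrongConvexOn X 1 ψ) {g : StrongDual ℝ E} {a L : ℝ}
    (ha : 0 < a) (hg : ‖g‖ ≤ L) {u v : E} (hu : u ∈ X) (hv : v ∈ X)
    (hmin : IsMinOn (fun y => g y + (1 / a) * bregman X ψ y u) X v) :
    ‖v - u‖ ≤ a * L := by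
  have h := mirror_step_three_point hsc.1 hψ hv hmin hu
  rw [bregman_self] at h
  have h1 := half_sq_le_bregman hψ hsc hu hv
  have h2 := half_sq_le_bregman hψ hsc hv hu
  rw [norm_sub_rev] at h1
  have h3 : -(L * ‖v - u‖) ≤ g (v - u) := by
    have := (abs_le.1 ((Real.norm_eq_abs _ ▸ g.le_opNorm (v - u)))).1
    have := mul_le_mul_of_nonneg_right hg (norm_nonneg (v - u))
    linarith
  have h4 : (1 / a) * ‖v - u‖ ^ 2 ≤ L * ‖v - u‖ := by
    have := mul_le_mul_of_nonneg_left (add_le_add h1 h2) (by positivity : 0 ≤ 1 / a)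
    nlinarith
  have h5 : ‖v - u‖ ^ 2 ≤ a * L * ‖v - u‖ := by
    have := mul_le_mul_of_nonneg_left h4 ha.le
    rwa [← mul_assoc, mul_one_div_cancel ha.ne', one_mul, ← mul_assoc] at this
  rcases (norm_nonneg (v - u)).eq_or_lt with h0 | h0
  · rw [← h0]; exact mul_nonneg ha.le ((norm_nonneg g).trans hg)
  · rw [sq] at h5; exact le_of_mul_le_mul_right h5 h0

/-- Split g(u - y) = g(u - v) + g(v - y). The term -D(v,u)/a from the three-point inequality absorbs
g(u - v) by Young's inequality, leaving aL²/2. -/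
lemma mirror_step_regret {X : Set E} {ψ : E → ℝ}
    (hψ : DifferentiableOn ℝ ψ X) (hsc : StrongConvexOn X 1 ψ) {g : StrongDual ℝ E} {a L : ℝ}
    (ha : 0 < a) (hg : ‖g‖ ≤ L) {u v : E} (hu : u ∈ X) (hv : v ∈ X)
    (hmin : IsMinOn (fun y => g y + (1 / a) * bregman X ψ y u) X v) {y : E} (hy : y ∈ X) :
    g (u - y) ≤ (1 / a) * (bregman X ψ y u - bregman X ψ y v) + a * L ^ 2 / 2 := by
  have h := mirror_step_three_point hsc.1 hψ hv hmin hy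
  have h2 := mul_le_mul_of_nonneg_left (half_sq_le_bregman hψ hsc hv hu)
    (by positivity : 0 ≤ 1 / a)
  have h3 : g (u - v) ≤ L * ‖v - u‖ := by
    refine (le_abs_self _).trans ?_
    rw [← Real.norm_eq_abs, norm_sub_rev v u]
    exact (g.le_opNorm _).trans (mul_le_mul_of_nonneg_right hg (norm_nonneg _))
  have h4 : L * ‖v - u‖ ≤ (1 / a) * (1 / 2 * ‖v - u‖ ^ 2) + a * L ^ 2 / 2 := by
    have : (1 / a) * (1 / 2 * ‖v - u‖ ^ 2) + a * L ^ 2 / 2 - L * ‖v - u‖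
        = (1 / (2 * a)) * (‖v - u‖ - a * L) ^ 2 := by field_simp; ring
    have h0 : 0 ≤ (1 / (2 * a)) * (‖v - u‖ - a * L) ^ 2 := by positivity
    linarith
  have e : g (u - y) = g (u - v) + g (v - y) := by rw [← map_add]; congr 1; abel
  rw [e]
  linarith

end MirrorStep

/-! ### Elementary facts on sums and averages -/

lemma sum_mul_sub_succ_le {c D : ℕ → ℝ} {B : ℝ} (hc0 : 0 ≤ c 0) (hc : Monotone c)
    (hD0 : ∀ n, 0 ≤ D n) (hDB : ∀ n, D n ≤ B) (n : ℕ) :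
    ∑ i ∈ Finset.range n, c i * (D i - D (i + 1)) ≤ c n * B := by
  -- The induction needs the unused room B - D n on the right: raising the weight from c n to c
  -- (n+1) is paid for by it.
  have key : ∀ n, ∑ i ∈ Finset.range n, c i * (D i - D (i + 1)) ≤ c n * (B - D n) := by
    intro n
    induction n with
    | zero => simpa using mul_nonneg hc0 (sub_nonneg.2 (hDB 0))
    | succ n ih =>
      rw [Finset.sum_range_succ]
      have h1 := mul_le_mul_of_nonneg_right (hc n.le_succ) (sub_nonneg.2 (hDB (n + 1)))
      simp only [Nat.succ_eq_add_one] at h1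
      linarith
  refine (key n).trans (mul_le_mul_of_nonneg_left ?_ (hc0.trans (hc n.zero_le)))
  linarith [hD0 n]

lemma tendsto_const_div_sqrt_succ (a : ℝ) :
    Tendsto (fun n : ℕ => a / √((n + 1 : ℕ) : ℝ)) atTop (𝓝 0) := by
  refine Tendsto.div_atTop tendsto_const_nhds ?_
  exact Real.tendsto_sqrt_atTop.comp
    (tendsto_natCast_atTop_atTop.comp (tendsto_add_atTop_nat 1))

lemma average_succ {E Ω : Type*} [NormedAddCommGroup E] [NormedSpace ℝ E] (x : ℕ → Ω → E)
    (T : ℕ) (ω : Ω) :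
    average x T ω = (T : ℝ)⁻¹ • ∑ i ∈ Finset.range T, x (i + 1) ω := by
  rw [average, one_div, Finset.range_eq_Ico, Finset.sum_Ico_add' (fun t => x t ω) 0 T 1]
  rfl

/-! ### Strong law for variables orthogonal at a fixed distance -/

section LawOfLargeNumbers

variable {Ω : Type*} [MeasurableSpace Ω] {P : Measure Ω} [IsProbabilityMeasure P]

/-- After expanding the square, only pairs at distance at most k can contribute, at most 2k in each
row. -/
lemma integral_sum_sq_le {Z : ℕ → Ω → ℝ} (hZ : ∀ n, Measurable (Z n)) {B : ℝ}
    (hB : ∀ n ω, |Z n ω| ≤ B) {k : ℕ} (horth : ∀ s t, s + k ≤ t → ∫ ω, Z s ω * Z t ω ∂P = 0)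
    (T : ℕ) : ∫ ω, (∑ i ∈ Finset.range T, Z i ω) ^ 2 ∂P ≤ T * (2 * k * B ^ 2) := by
  have hmul : ∀ i j ω, |Z i ω * Z j ω| ≤ B ^ 2 := fun i j ω => by
    rw [abs_mul, sq]
    exact mul_le_mul (hB i ω) (hB j ω) (abs_nonneg _) ((abs_nonneg _).trans (hB i ω))
  have hint : ∀ i j, Integrable (fun ω => Z i ω * Z j ω) P := fun i j =>
    Integrable.of_bound ((hZ i).mul (hZ j)).aestronglyMeasurable (B ^ 2)
      (ae_of_all _ fun ω => hmul i j ω)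
  simp_rw [sq (∑ i ∈ Finset.range T, Z i _), Finset.sum_mul_sum]
  rw [integral_finsetSum _ fun i _ => integrable_finsetSum _ fun j _ => hint i j]
  have hrow : ∀ i ∈ Finset.range T,
      ∫ ω, ∑ j ∈ Finset.range T, Z i ω * Z j ω ∂P ≤ 2 * k * B ^ 2 := fun i _ => by
    rw [integral_finsetSum _ fun j _ => hint i j]
    have hterm : ∀ j ∈ Finset.range T,
        ∫ ω, Z i ω * Z j ω ∂P ≤ if j ∈ Finset.Ico (i - k) (i + k) then B ^ 2 else 0 := by
      intro j _
      split_ifs with hj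
      · refine (integral_mono (hint i j) (integrable_const (B ^ 2))
          fun ω => (le_abs_self _).trans (hmul i j ω)).trans ?_
        simp
      · rw [Finset.mem_Ico] at hj
        by_cases h : i + k ≤ j
        · exact (horth i j h).le
        · simp_rw [mul_comm (Z i _)]
          exact (horth j i (by omega)).le
    refine (Finset.sum_le_sum hterm).trans ?_
    rw [← Finset.sum_filter, Finset.sum_const, nsmul_eq_mul]
    refine mul_le_mul_of_nonneg_right ?_ (sq_nonneg B)
    have : ((Finset.range T).filter (· ∈ Finset.Ico (i - k) (i + k))).card ≤ 2 * k := by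
      refine (Finset.card_le_card fun j hj => (Finset.mem_filter.1 hj).2).trans ?_
      rw [Nat.card_Ico]; omega
    exact_mod_cast this
  refine (Finset.sum_le_sum hrow).trans ?_
  simp

/-- Between r² and T < (r+1)² there are at most 2r further terms; dividing 2rB by r² gives 2B/r.
Thus convergence along squares suffices. -/
lemma abs_sum_div_le_of_sq {z : ℕ → ℝ} {B : ℝ} (hB : ∀ n, |z n| ≤ B) {T : ℕ} (hT : 1 ≤ T) :
    |(∑ i ∈ Finset.range T, z i) / T| ≤
      |(∑ i ∈ Finset.range (T.sqrt ^ 2), z i) / ((T.sqrt ^ 2 : ℕ) : ℝ)| + 2 * B / T.sqrt := by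
  have hr : 0 < T.sqrt := Nat.sqrt_pos.2 hT
  have hle : T.sqrt ^ 2 ≤ T := Nat.sqrt_le' T
  have hlt : T < T.sqrt ^ 2 + 2 * T.sqrt + 1 := by
    have := Nat.lt_succ_sqrt' T
    simp only [Nat.succ_eq_add_one] at this
    nlinarith
  have hrR : (0 : ℝ) < T.sqrt := by exact_mod_cast hr
  have hTR : ((T.sqrt ^ 2 : ℕ) : ℝ) ≤ T := by exact_mod_cast hle
  have hB0 : 0 ≤ B := (abs_nonneg _).trans (hB 0)
  have hsplit := Finset.sum_range_add_sum_Ico z hle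
  have htail : |∑ i ∈ Finset.Ico (T.sqrt ^ 2) T, z i| ≤ 2 * T.sqrt * B := by
    refine (Finset.abs_sum_le_sum_abs _ _).trans ((Finset.sum_le_card_nsmul _ _ B
      fun i _ => hB i).trans ?_)
    rw [Nat.card_Ico, nsmul_eq_mul]
    refine mul_le_mul_of_nonneg_right ?_ hB0
    have : T - T.sqrt ^ 2 ≤ 2 * T.sqrt := by omega
    exact_mod_cast this
  have hsq : (0 : ℝ) < ((T.sqrt ^ 2 : ℕ) : ℝ) := by push_cast; positivity
  rw [abs_div, abs_div, Nat.abs_cast, Nat.abs_cast, ← hsplit]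
  calc _ ≤ (|∑ i ∈ Finset.range (T.sqrt ^ 2), z i| + 2 * T.sqrt * B) / T := by
        gcongr
        exact (abs_add_le _ _).trans (by linarith)
    _ ≤ (|∑ i ∈ Finset.range (T.sqrt ^ 2), z i| + 2 * T.sqrt * B) / ((T.sqrt ^ 2 : ℕ) : ℝ) := by
        gcongr
    _ = _ := by
        rw [add_div]
        congr 1
        push_cast
        field_simp

/-- A strong law of large numbers for bounded variables that are orthogonal at distance `k`. -/
lemma ae_tendsto_average_of_orthogonal {Z : ℕ → Ω → ℝ} (hZ : ∀ n, Measurable (Z n)) {B : ℝ}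
    (hB : ∀ n ω, |Z n ω| ≤ B) {k : ℕ}
    (horth : ∀ s t, s + k ≤ t → ∫ ω, Z s ω * Z t ω ∂P = 0) :
    ∀ᵐ ω ∂P, Tendsto (fun T : ℕ => (∑ i ∈ Finset.range T, Z i ω) / T) atTop (𝓝 0) := by
  set A : ℕ → Ω → ℝ := fun m ω => (∑ i ∈ Finset.range (m ^ 2), Z i ω) / ((m ^ 2 : ℕ) : ℝ) with hA
  have hAmeas : ∀ m, Measurable (A m) := fun m =>
    (Finset.measurable_fun_sum _ fun i _ => hZ i).div_const _
  have hmom : ∀ m : ℕ, ∫⁻ ω, ENNReal.ofReal (A m ω ^ 2) ∂P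
      ≤ ENNReal.ofReal (2 * k * B ^ 2 * (1 / (m : ℝ) ^ 2)) := by
    intro m
    have hAb : ∀ ω, |A m ω| ≤ B := fun ω => by
      have hB0 : 0 ≤ B := (abs_nonneg _).trans (hB 0 ω)
      rw [hA, abs_div, Nat.abs_cast]
      refine div_le_of_le_mul₀ (Nat.cast_nonneg _) hB0 ?_
      refine (Finset.abs_sum_le_sum_abs _ _).trans ((Finset.sum_le_card_nsmul _ _ B
        fun i _ => hB i ω).trans ?_)
      rw [Finset.card_range, nsmul_eq_mul, mul_comm]
    rw [← ofReal_integral_eq_lintegral_ofReal _ (ae_of_all _ fun ω => sq_nonneg _)]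
    · refine ENNReal.ofReal_le_ofReal ?_
      simp_rw [hA, div_pow]
      rw [integral_div]
      have h := integral_sum_sq_le hZ hB horth (m ^ 2)
      rcases Nat.eq_zero_or_pos m with rfl | hm
      · simp
      · have hm' : (0 : ℝ) < m := by exact_mod_cast hm
        rw [div_le_iff₀ (by push_cast; positivity)]
        refine h.trans (le_of_eq ?_)
        push_cast
        field_simp
    · refine Integrable.of_bound ((hAmeas m).pow_const 2).aestronglyMeasurable (B ^ 2)
        (ae_of_all _ fun ω => ?_)
      rw [Real.norm_eq_abs, abs_pow]
      exact pow_le_pow_left₀ (abs_nonneg _) (hAb ω) 2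
  -- The second moments along squares are O(1/m²), hence summable. By Tonelli the series of squares
  -- is almost surely finite, so its terms tend to 0.
  have hfin : ∫⁻ ω, ∑' m, ENNReal.ofReal (A m ω ^ 2) ∂P ≠ ∞ := by
    rw [lintegral_tsum fun m => ((hAmeas m).pow_const 2).ennreal_ofReal.aemeasurable]
    have hs : Summable fun m : ℕ => 2 * k * B ^ 2 * (1 / (m : ℝ) ^ 2) :=
      (Real.summable_one_div_nat_pow.2 one_lt_two).mul_left _
    refine ne_top_of_le_ne_top hs.tsum_ofReal_ne_top (ENNReal.tsum_le_tsum hmom)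
  have hae := ae_lt_top' (AEMeasurable.tsum fun m =>
    ((hAmeas m).pow_const 2).ennreal_ofReal.aemeasurable) hfin
  filter_upwards [hae] with ω hω
  have h0 := ENNReal.tendsto_atTop_zero_of_tsum_ne_top hω.ne
  have h1 : Tendsto (fun m => |A m ω|) atTop (𝓝 0) := by
    have h2 : Tendsto (fun m => A m ω ^ 2) atTop (𝓝 0) := by
      have := (ENNReal.tendsto_toReal ENNReal.zero_ne_top).comp h0
      refine this.congr fun m => ?_
      simp [ENNReal.toReal_ofReal (sq_nonneg (A m ω))]
    have := (Real.continuous_sqrt.tendsto 0).comp h2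
    rw [Real.sqrt_zero] at this
    exact this.congr fun m => Real.sqrt_sq_eq_abs _
  have hsqrt : Tendsto Nat.sqrt atTop atTop := by
    refine tendsto_atTop.2 fun b => ?_
    filter_upwards [eventually_ge_atTop (b * b)] with n hn
    exact Nat.le_sqrt.2 hn
  have h3 : Tendsto (fun T : ℕ => |A T.sqrt ω| + 2 * B / T.sqrt) atTop (𝓝 (0 + 0)) :=
    (h1.comp hsqrt).add
      (tendsto_const_nhds.div_atTop (tendsto_natCast_atTop_atTop.comp hsqrt))
  rw [add_zero] at h3
  refine squeeze_zero_norm' ?_ h3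
  filter_upwards [eventually_ge_atTop 1] with T hT
  exact abs_sum_div_le_of_sq (fun n => hB n ω) hT

end LawOfLargeNumbers

/-! ### Integration against a conditional law -/

section Conditioning

variable {Ω Ξ S : Type*} [MeasurableSpace Ξ] [MeasurableSpace S]

/-- The joint law of (W, Y) is the image of P ⊗ κ under (W, id): on rectangles this is the defining
property of conditional probability, as W⁻¹(s) lies in m. -/
lemma IsCondLaw.integral_comp {m mΩ : MeasurableSpace Ω} {P : Measure Ω} [IsProbabilityMeasure P]
    (hm : m ≤ mΩ) {Y : Ω → Ξ} (hY : Measurable Y) {κ : Ω → Measure Ξ} (h : IsCondLaw P m Y κ)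
    {W : Ω → S} (hW : Measurable[m] W) {g : S × Ξ → ℝ} (hg : Measurable g) {B : ℝ}
    (hB : ∀ ω z, |g (W ω, z)| ≤ B) :
    ∫ ω, g (W ω, Y ω) ∂P = ∫ ω, ∫ z, g (W ω, z) ∂(κ ω) ∂P := by
  have hW' : Measurable W := hW.mono hm le_rfl
  let K : Kernel Ω Ξ := ⟨κ, h.measurable.mono hm le_rfl⟩
  have : IsMarkovKernel K := ⟨h.prob⟩
  have hmeas : P.map (fun ω => (W ω, Y ω)) = (P ⊗ₘ K).map (Prod.map W id) := by
    have : IsProbabilityMeasure (P.map fun ω => (W ω, Y ω)) :=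
      Measure.isProbabilityMeasure_map (hW'.prodMk hY).aemeasurable
    refine Measure.ext_prod fun {s t} hs ht => ?_
    rw [Measure.map_apply (hW'.prodMk hY) (hs.prod ht),
      Measure.map_apply (hW'.prodMap measurable_id) (hs.prod ht)]
    have e1 : (Prod.map W (id : Ξ → Ξ)) ⁻¹' (s ×ˢ t) = (W ⁻¹' s) ×ˢ t := by ext; simp
    have e2 : (fun ω => (W ω, Y ω)) ⁻¹' (s ×ˢ t) = Y ⁻¹' t ∩ W ⁻¹' s := by
      ext; simp [and_comm]
    rw [e1, e2, Measure.compProd_apply_prod (hW' hs) ht]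
    have hset : ∫ ω in W ⁻¹' s, (P⟦Y ⁻¹' t | m⟧) ω ∂P
        = ∫ ω in W ⁻¹' s, (Y ⁻¹' t).indicator (fun _ => (1 : ℝ)) ω ∂P :=
      setIntegral_condExp hm ((integrable_const 1).indicator (hY ht)) (hW hs)
    rw [← integral_congr_ae (ae_restrict_of_ae (h.condProb t ht)),
      integral_indicator_const _ (hY ht), smul_eq_mul, mul_one,
      measureReal_restrict_apply (hY ht)] at hset
    have hKm : Measurable fun ω => K ω t := K.measurable_coe ht
    have hint : Integrable (fun ω => (κ ω).real t) (P.restrict (W ⁻¹' s)) := by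
      refine Integrable.of_bound hKm.ennreal_toReal.aestronglyMeasurable 1 (ae_of_all _ fun ω => ?_)
      have := h.prob ω
      rw [Real.norm_of_nonneg measureReal_nonneg]
      exact measureReal_le_one
    rw [← ofReal_measureReal, ← hset,
      ofReal_integral_eq_lintegral_ofReal hint (ae_of_all _ fun _ => measureReal_nonneg)]
    refine lintegral_congr fun ω => ?_
    have := h.prob ω
    exact ofReal_measureReal
  rw [← integral_map (f := g) (hW'.prodMk hY).aemeasurable hg.aestronglyMeasurable, hmeas,
    integral_map (hW'.prodMap measurable_id).aemeasurable hg.aestronglyMeasurable,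
    Measure.integral_compProd]
  · rfl
  · exact Integrable.of_bound (hg.comp (hW'.prodMap measurable_id)).aestronglyMeasurable B
      (ae_of_all _ fun p => hB _ _)

lemma measurable_integral_of_measurable_law [MeasurableSpace Ω] {κ : Ω → Measure Ξ}
    (hκ : Measurable κ) (hprob : ∀ ω, IsProbabilityMeasure (κ ω)) {W : Ω → S} (hW : Measurable W)
    {g : S × Ξ → ℝ} (hg : Measurable g) :
    Measurable fun ω => ∫ z, g (W ω, z) ∂(κ ω) := by
  let K : Kernel Ω Ξ := ⟨κ, hκ⟩
  have : IsMarkovKernel K := ⟨hprob⟩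
  have h2 : StronglyMeasurable (Function.uncurry fun (ω : Ω) (z : Ξ) => g (W ω, z)) :=
    (hg.comp ((hW.comp measurable_fst).prodMk measurable_snd)).stronglyMeasurable
  exact (StronglyMeasurable.integral_kernel_prod_right (κ := K) h2).measurable

end Conditioning

/-! ### Mixing times and centred averages -/

section Mixing

variable {Ω Ξ : Type*} [MeasurableSpace Ξ]

lemma abs_integral_sub_le_mul_tvDist (p q : Measure Ξ) [IsFiniteMeasure p] [IsFiniteMeasure q]
    {h : Ξ → ℝ} (hh : Measurable h) {C : ℝ} (hC : ∀ z, |h z| ≤ C) :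
    |∫ z, h z ∂p - ∫ z, h z ∂q| ≤ C * tvDist p q := by
  have hp : p ≪ p + q := Measure.AbsolutelyContinuous.rfl.add_right q
  have hq : q ≪ p + q := by rw [add_comm]; exact Measure.AbsolutelyContinuous.rfl.add_right p
  have ip : Integrable (fun z => (p.rnDeriv (p + q) z).toReal) (p + q) :=
    Measure.integrable_toReal_rnDeriv
  have iq : Integrable (fun z => (q.rnDeriv (p + q) z).toReal) (p + q) :=
    Measure.integrable_toReal_rnDeriv
  have iph : Integrable (fun z => (p.rnDeriv (p + q) z).toReal • h z) (p + q) :=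
    ip.mul_bdd (c := C) hh.aestronglyMeasurable (ae_of_all _ hC)
  have iqh : Integrable (fun z => (q.rnDeriv (p + q) z).toReal • h z) (p + q) :=
    iq.mul_bdd (c := C) hh.aestronglyMeasurable (ae_of_all _ hC)
  rw [← integral_rnDeriv_smul hp, ← integral_rnDeriv_smul hq, ← integral_sub iph iqh, tvDist,
    ← integral_const_mul, ← Real.norm_eq_abs]
  refine norm_integral_le_of_norm_le ((ip.sub iq).abs.const_mul C) (ae_of_all _ fun z => ?_)
  rw [← sub_smul, norm_smul, mul_comm, Real.norm_eq_abs, Real.norm_eq_abs]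
  exact mul_le_mul_of_nonneg_right (hC z) (abs_nonneg _)

/-- A finite bound excludes the empty set, whose infimum is ⊤, and a nonempty set in ℕ∞ attains its
infimum. -/
lemma dist_le_of_mixingTime_le {d : Measure Ξ → Measure Ξ → ℝ} {ν : Measure Ξ}
    {ρ : ℕ → Measure Ξ} {s n : ℕ} {ε : ℝ} (h : mixingTime d ν ρ s ε ≤ n) :
    1 ≤ n ∧ ∀ t, s + n ≤ t → d (ρ t) ν ≤ ε := by
  have hne : {N : ℕ∞ | ∃ n : ℕ, N = n ∧ 1 ≤ n ∧ ∀ t, s + n ≤ t → d (ρ t) ν ≤ ε}.Nonempty := by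
    by_contra hcon
    rw [Set.not_nonempty_iff_eq_empty] at hcon
    rw [mixingTime, hcon, sInf_empty] at h
    exact absurd h (not_le.2 (ENat.natCast_lt_top n))
  obtain ⟨k, hk, hk1, hkt⟩ := csInf_mem hne
  rw [mixingTime, hk, Nat.cast_le] at h
  exact ⟨hk1.trans h, fun t ht => hkt t (by omega)⟩

lemma pastSigma_le [mΩ : MeasurableSpace Ω] {ξ : ℕ → Ω → Ξ} (hξ : ∀ t, 1 ≤ t → Measurable (ξ t)) (s : ℕ) :
    pastSigma ξ s ≤ mΩ :=
  iSup₂_le fun i hi => (hξ i (Finset.mem_Icc.1 hi).1).comap_le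

lemma pastSigma_mono (ξ : ℕ → Ω → Ξ) {s t : ℕ} (h : s ≤ t) : pastSigma ξ s ≤ pastSigma ξ t :=
  biSup_mono fun _ hi => Finset.Icc_subset_Icc le_rfl h hi

lemma measurable_pastSigma (ξ : ℕ → Ω → Ξ) {i s : ℕ} (hi : 1 ≤ i) (his : i ≤ s) :
    Measurable[pastSigma ξ s] (ξ i) :=
  (comap_measurable (ξ i)).mono
    (le_iSup₂_of_le (f := fun i (_ : i ∈ Finset.Icc 1 s) =>
      MeasurableSpace.comap (ξ i) inferInstance) i (Finset.mem_Icc.2 ⟨hi, his⟩) le_rfl) le_rfl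

/-- Centred at their conditional expectations given the past, bounded functions of a
past-measurable variable and of the sample `k` steps ahead average out almost surely. -/
lemma ae_tendsto_average_centred [mΩ : MeasurableSpace Ω] {P : Measure Ω} [IsProbabilityMeasure P]
    {S : Type*} [MeasurableSpace S] {ξ : ℕ → Ω → Ξ} (hξ : ∀ t, 1 ≤ t → Measurable (ξ t))
    {k : ℕ} (hk : 1 ≤ k) {κ : ℕ → Ω → Measure Ξ}
    (hκ : ∀ n, IsCondLaw P (pastSigma ξ n) (ξ (n + k)) (κ n)) {W : ℕ → Ω → S}
    (hW : ∀ n, Measurable[pastSigma ξ n] (W n)) {h : S × Ξ → ℝ} (hh : Measurable h) {B : ℝ}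
    (hB : ∀ p, |h p| ≤ B) :
    ∀ᵐ ω ∂P, Tendsto (fun T : ℕ => (∑ n ∈ Finset.range T,
      (h (W n ω, ξ (n + k) ω) - ∫ z, h (W n ω, z) ∂(κ n ω))) / T) atTop (𝓝 0) := by
  have hI : ∀ n, Measurable[pastSigma ξ n] fun ω => ∫ z, h (W n ω, z) ∂(κ n ω) := fun n =>
    @measurable_integral_of_measurable_law Ω Ξ S _ _ (pastSigma ξ n) (κ n) (hκ n).measurable
      (hκ n).prob (W n) (hW n) h hh
  have hIB : ∀ n ω, |∫ z, h (W n ω, z) ∂(κ n ω)| ≤ B := fun n ω => by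
    have := (hκ n).prob ω
    simpa using norm_integral_le_of_norm_le_const (μ := κ n ω)
      (f := fun z => h (W n ω, z)) (ae_of_all _ fun z => hB (W n ω, z))
  have hZ : ∀ n, Measurable[pastSigma ξ (n + k)] fun ω =>
      h (W n ω, ξ (n + k) ω) - ∫ z, h (W n ω, z) ∂(κ n ω) := fun n => by
    have hle := pastSigma_mono ξ (Nat.le_add_right n k)
    exact Measurable.sub (hh.comp (((hW n).mono hle le_rfl).prodMk
      (measurable_pastSigma ξ (by omega) le_rfl))) ((hI n).mono hle le_rfl)
  have hZB : ∀ n ω, |h (W n ω, ξ (n + k) ω) - ∫ z, h (W n ω, z) ∂(κ n ω)| ≤ B + B := fun n ω =>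
    (abs_sub _ _).trans (add_le_add (hB _) (hIB n ω))
  refine ae_tendsto_average_of_orthogonal (fun n => (hZ n).mono (pastSigma_le hξ _) le_rfl) hZB
    (k := k) fun s t hst => ?_
  set Z : Ω → ℝ := fun ω => h (W s ω, ξ (s + k) ω) - ∫ z, h (W s ω, z) ∂(κ s ω) with hZdef
  have hle := pastSigma_le hξ t
  have hZt : Measurable[pastSigma ξ t] Z := (hZ s).mono (pastSigma_mono ξ hst) le_rfl
  -- Since s + k ≤ t, the earlier centred variable Z is known at time t. Conditioning with the pair
  -- (Z, W t) frozen therefore pulls Z out of the inner integral.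
  have hcond := (hκ t).integral_comp hle (hξ (t + k) (by omega))
    (W := fun ω => (Z ω, W t ω)) (hZt.prodMk (hW t))
    (g := fun p => p.1.1 * h (p.1.2, p.2)) (by fun_prop) (B := (B + B) * B) fun ω z => by
      rw [abs_mul]
      exact mul_le_mul (hZB s ω) (hB _) (abs_nonneg _) ((abs_nonneg _).trans (hZB s ω))
  simp_rw [integral_const_mul] at hcond
  have hZm := hZt.mono hle le_rfl
  have i1 : Integrable (fun ω => Z ω * h (W t ω, ξ (t + k) ω)) P := by
    refine Integrable.of_bound (C := (B + B) * B) (hZm.mul (hh.comp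
      (((hW t).mono hle le_rfl).prodMk (hξ (t + k) (by omega))))).aestronglyMeasurable
      (ae_of_all _ fun ω => ?_)
    rw [norm_mul]
    exact mul_le_mul (hZB s ω) (hB _) (norm_nonneg _) ((abs_nonneg _).trans (hZB s ω))
  have i2 : Integrable (fun ω => Z ω * ∫ z, h (W t ω, z) ∂(κ t ω)) P := by
    refine Integrable.of_bound (C := (B + B) * B)
      (hZm.mul ((hI t).mono hle le_rfl)).aestronglyMeasurable (ae_of_all _ fun ω => ?_)
    rw [norm_mul]
    exact mul_le_mul (hZB s ω) (hIB t ω) (norm_nonneg _) ((abs_nonneg _).trans (hZB s ω))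
  simp_rw [mul_sub]
  rw [integral_sub i1 i2, hcond, sub_self]

end Mixing

/-! ### Measurability of the iterates -/

section IterateMeasurability

variable {E : Type*} [NormedAddCommGroup E] [NormedSpace ℝ E]

lemma measurable_bregman_right [MeasurableSpace E] [BorelSpace E] {X : Set E} (hX : Convex ℝ X) {ψ : E → ℝ}
    (hψ : DifferentiableOn ℝ ψ X) (y : X) : Measurable fun u : X => bregman X ψ y u := by
  have hc : Continuous (X.domRestrict ψ) := hψ.continuousOn.domRestrict
  have hlim : Measurable fun u : X => fderivWithin ℝ ψ X u ((y : E) - u) := by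
    refine measurable_of_tendsto_metrizable (f := fun (n : ℕ) (u : X) => ((n : ℝ) + 1) *
      (ψ (u + (1 / ((n : ℝ) + 1)) • ((y : E) - u)) - ψ u)) (fun n => ?_)
      (tendsto_pi_nhds.2 fun u => tendsto_slope_fderivWithin hX hψ y.2 u.2)
    have hmem : ∀ u : X, (u : E) + (1 / ((n : ℝ) + 1)) • ((y : E) - u) ∈ X := fun u => by
      have hn : (0 : ℝ) < (n : ℝ) + 1 := by positivity
      refine hX.add_smul_sub_mem u.2 y.2 ⟨by positivity, ?_⟩
      rw [div_le_one hn]; linarith [(Nat.cast_nonneg n : (0 : ℝ) ≤ n)]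
    have h1 : Continuous fun u : X => ψ ((u : E) + (1 / ((n : ℝ) + 1)) • ((y : E) - u)) :=
      hc.comp (Continuous.subtype_mk (by fun_prop) hmem)
    exact (continuous_const.mul (h1.sub hc)).measurable
  exact (measurable_const.sub hc.measurable).sub hlim

lemma continuous_bregman_left {X : Set E} {ψ : E → ℝ} (hψ : DifferentiableOn ℝ ψ X) (u : E) :
    Continuous fun y : X => bregman X ψ y u := by
  have hc : Continuous (X.domRestrict ψ) := hψ.continuousOn.domRestrict
  unfold bregman
  exact (hc.sub continuous_const).sub (by fun_prop)

/-- The minimizer is the limit of the first 1/(k+1)-optimal points of a fixed dense sequence, by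
quadratic growth. -/
lemma measurable_mirror_step [MeasurableSpace E] [BorelSpace E] [FiniteDimensional ℝ E]
    {Ω : Type*} [MeasurableSpace Ω] {X : Set E}
    {ψ : E → ℝ} (hψ : DifferentiableOn ℝ ψ X) (hsc : StrongConvexOn X 1 ψ) {c : ℝ} (hc : 0 < c)
    {u : Ω → X} (hu : Measurable u) {g : Ω → StrongDual ℝ E} (hg : Measurable g) {v : Ω → E}
    (hv : ∀ ω, v ω ∈ X)
    (hmin : ∀ ω, IsMinOn (fun y => g ω y + c * bregman X ψ y (u ω)) X (v ω)) :
    Measurable v := by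
  classical
  rcases isEmpty_or_nonempty Ω with hΩ | ⟨⟨ω₀⟩⟩
  · exact measurable_of_empty v
  have : Nonempty X := ⟨u ω₀⟩
  have : ProperSpace E := FiniteDimensional.proper_real E
  set D : ℕ → X := TopologicalSpace.denseSeq X with hD
  have hdense : DenseRange D := TopologicalSpace.denseRange_denseSeq X
  set φ : Ω → X → ℝ := fun ω y => g ω y + c * bregman X ψ y (u ω) with hφ
  have hφc : ∀ ω, Continuous (φ ω) := fun ω =>
    ((g ω).continuous.comp continuous_subtype_val).add
      (continuous_const.mul (continuous_bregman_left hψ (u ω)))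
  have hφm : ∀ y, Measurable fun ω => φ ω y := fun y => by
    refine Measurable.add ?_ (measurable_const.mul
      ((measurable_bregman_right hsc.1 hψ y).comp hu))
    exact hg.apply_continuousLinearMap (y : E)
  -- Near-optimality is required only against the dense sequence, so it is a countable intersection
  -- of measurable events. Continuity later extends it to the true minimizer.
  have hex : ∀ (k : ℕ) (ω : Ω), ∃ n, ∀ j, φ ω (D n) ≤ φ ω (D j) + 1 / ((k : ℝ) + 1) := by
    intro k ω
    have hpos : (0 : ℝ) < 1 / ((k : ℝ) + 1) := by positivity
    obtain ⟨n, hn⟩ := hdense.exists_mem_open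
      (isOpen_Iio.preimage (hφc ω) : IsOpen (φ ω ⁻¹' Set.Iio (φ ω ⟨v ω, hv ω⟩ + 1 / ((k : ℝ) + 1))))
      ⟨⟨v ω, hv ω⟩, by simpa using hpos⟩
    refine ⟨n, fun j => (le_of_lt hn).trans ?_⟩
    have := hmin ω (D j).2
    simp only [Set.mem_ofPred_eq] at this
    exact add_le_add_left this _
  have hfind : ∀ k, Measurable fun ω => Nat.find (hex k ω) := fun k =>
    measurable_find (hex k) fun n => by
      rw [Set.ofPred_forall]
      exact MeasurableSet.iInter fun j =>
        measurableSet_le (hφm (D n)) ((hφm (D j)).add_const _)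
  refine measurable_of_tendsto_metrizable
    (f := fun (k : ℕ) ω => (D (Nat.find (hex k ω)) : E))
    (fun k => (measurable_from_nat (f := fun n => (D n : E))).comp (hfind k))
    (tendsto_pi_nhds.2 fun ω => ?_)
  have hbound : ∀ k : ℕ, ‖(D (Nat.find (hex k ω)) : E) - v ω‖ ^ 2
      ≤ 2 / c * (1 / ((k : ℝ) + 1)) := by
    intro k
    have h1 := mirror_step_growth hψ hsc hc.le (hv ω) (hmin ω) (D (Nat.find (hex k ω))).2
    have h2 : φ ω (D (Nat.find (hex k ω))) ≤ φ ω ⟨v ω, hv ω⟩ + 1 / ((k : ℝ) + 1) := by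
      have hcl : IsClosed {y : X | φ ω (D (Nat.find (hex k ω))) ≤ φ ω y + 1 / ((k : ℝ) + 1)} :=
        isClosed_le continuous_const ((hφc ω).add continuous_const)
      exact hdense.induction_on ⟨v ω, hv ω⟩ hcl (Nat.find_spec (hex k ω))
    have h3 : c * (1 / 2 * ‖(D (Nat.find (hex k ω)) : E) - v ω‖ ^ 2) ≤ 1 / ((k : ℝ) + 1) := by
      simp only [hφ] at h2
      linarith
    have e : ∀ r : ℝ, r = 2 / c * (c * (1 / 2 * r)) := fun r => by field_simp
    exact (e _).le.trans (mul_le_mul_of_nonneg_left h3 (by positivity))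
  rw [tendsto_iff_norm_sub_tendsto_zero]
  have hsq : Tendsto (fun k => ‖(D (Nat.find (hex k ω)) : E) - v ω‖ ^ 2) atTop (𝓝 0) := by
    refine squeeze_zero (fun k => sq_nonneg _) hbound ?_
    simpa using (tendsto_one_div_add_atTop_nhds_zero_nat (𝕜 := ℝ)).const_mul (2 / c)
  have := (Real.continuous_sqrt.tendsto 0).comp hsq
  rw [Real.sqrt_zero] at this
  exact this.congr fun k => Real.sqrt_sq (norm_nonneg _)

lemma IsEMD.mem_of_one_le {Ω Ξ : Type*} {X : Set E} {ψ : E → ℝ} {G : E → Ξ → StrongDual ℝ E}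
    {ξ : ℕ → Ω → Ξ} {α : ℕ → ℝ} {x₁ : E} {x : ℕ → Ω → E} (hx : IsEMD X ψ G ξ α x₁ x)
    (hx₁ : x₁ ∈ X) {t : ℕ} (ht : 1 ≤ t) (ω : Ω) : x t ω ∈ X := by
  rcases ht.eq_or_lt with rfl | ht
  · rw [hx.init]; exact hx₁
  · obtain ⟨t, rfl⟩ := Nat.exists_eq_add_of_lt ht
    exact hx.mem _ (by omega) ω

lemma IsEMD.measurable_succ [MeasurableSpace E] [BorelSpace E] [FiniteDimensional ℝ E]
    {Ω Ξ : Type*} [MeasurableSpace Ξ]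
    {X : Set E} {ψ : E → ℝ} (hψ : DifferentiableOn ℝ ψ X) (hsc : StrongConvexOn X 1 ψ)
    {G : E → Ξ → StrongDual ℝ E} (hG : Measurable fun p : X × Ξ => G p.1 p.2)
    {ξ : ℕ → Ω → Ξ} {α : ℕ → ℝ} (hα : ∀ t, 1 ≤ t → 0 < α t) {x₁ : E} (hx₁ : x₁ ∈ X)
    {x : ℕ → Ω → E} (hx : IsEMD X ψ G ξ α x₁ x) (n : ℕ) :
    Measurable[pastSigma ξ n] (x (n + 1)) := by
  induction n with
  | zero =>
    have : x (0 + 1) = fun _ => x₁ := funext hx.init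
    rw [this]
    exact measurable_const
  | succ n ih =>
    -- Taking the past as the ambient σ-field makes the one-step lemma yield adaptedness.
    let _ : MeasurableSpace Ω := pastSigma ξ (n + 1)
    have hu : Measurable fun ω => (⟨x (n + 1) ω, hx.mem_of_one_le hx₁ (by omega) ω⟩ : X) :=
      (ih.mono (pastSigma_mono ξ n.le_succ) le_rfl).subtype_mk
    have hg : Measurable fun ω => G (x (n + 1) ω) (ξ (n + 1) ω) :=
      hG.comp (hu.prodMk (measurable_pastSigma ξ (by omega) le_rfl))
    exact measurable_mirror_step hψ hsc (one_div_pos.2 (hα (n + 1) (by omega))) hu hg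
      (hx.mem (n + 1) (by omega)) (hx.argmin (n + 1) (by omega))

end IterateMeasurability

/-! ### Pathwise regret and the shift argument -/

section Regret

variable {E : Type*} [NormedAddCommGroup E] [NormedSpace ℝ E]

lemma mirror_descent_regret {X : Set E} {ψ : E → ℝ} (hψ : DifferentiableOn ℝ ψ X)
    (hsc : StrongConvexOn X 1 ψ) {B : ℝ} (hB : ∀ x ∈ X, ∀ y ∈ X, bregman X ψ x y ≤ B)
    {α L : ℝ} (hα : 0 < α) {x : ℕ → E} (hx : ∀ n, x n ∈ X) {g : ℕ → StrongDual ℝ E}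
    (hg : ∀ n, ‖g n‖ ≤ L)
    (hmin : ∀ n, IsMinOn
      (fun y => g n y + (1 / (α / √((n + 1 : ℕ) : ℝ))) * bregman X ψ y (x n)) X (x (n + 1)))
    {y : E} (hy : y ∈ X) (T : ℕ) :
    ∑ n ∈ Finset.range T, g n (x n - y) ≤ 1 / (α / √((T + 1 : ℕ) : ℝ)) * B
      + L ^ 2 / 2 * ∑ n ∈ Finset.range T, α / √((n + 1 : ℕ) : ℝ) := by
  have hpos : ∀ n : ℕ, 0 < α / √((n + 1 : ℕ) : ℝ) := fun n =>
    div_pos hα (Real.sqrt_pos.2 (by positivity))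
  have h := sum_mul_sub_succ_le (c := fun n : ℕ => 1 / (α / √((n + 1 : ℕ) : ℝ)))
    (D := fun n => bregman X ψ y (x n)) (B := B) (one_div_pos.2 (hpos 0)).le
    (fun m n hmn => by
      refine one_div_le_one_div_of_le (hpos n) ?_
      refine div_le_div_of_nonneg_left hα.le (Real.sqrt_pos.2 (by positivity)) ?_
      exact Real.sqrt_le_sqrt (by exact_mod_cast Nat.succ_le_succ hmn))
    (fun n => (by positivity : (0 : ℝ) ≤ 1 / 2 * ‖y - x n‖ ^ 2).trans
      (half_sq_le_bregman hψ hsc hy (hx n)))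
    (fun n => hB y hy _ (hx n)) T
  refine (Finset.sum_le_sum fun n _ => mirror_step_regret hψ hsc (hpos n) (hg n) (hx n)
    (hx (n + 1)) (hmin n) hy).trans ?_
  rw [Finset.sum_add_distrib, Finset.mul_sum]
  refine add_le_add h (Finset.sum_le_sum fun n _ => le_of_eq ?_)
  ring

lemma mirror_descent_stable {X : Set E} {ψ : E → ℝ} (hψ : DifferentiableOn ℝ ψ X)
    (hsc : StrongConvexOn X 1 ψ) {α L : ℝ} (hα : 0 < α) {x : ℕ → E} (hx : ∀ n, x n ∈ X)
    {g : ℕ → StrongDual ℝ E} (hg : ∀ n, ‖g n‖ ≤ L)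
    (hmin : ∀ n, IsMinOn
      (fun y => g n y + (1 / (α / √((n + 1 : ℕ) : ℝ))) * bregman X ψ y (x n)) X (x (n + 1)))
    (n s : ℕ) : ‖x (n + s) - x n‖ ≤ s * L * (α / √((n + 1 : ℕ) : ℝ)) := by
  have hL : 0 ≤ L := (norm_nonneg _).trans (hg 0)
  induction s with
  | zero => simp
  | succ s ih =>
    have h1 := mirror_step_stable hψ hsc (div_pos hα (Real.sqrt_pos.2 (by positivity)))
      (hg (n + s)) (hx (n + s)) (hx (n + s + 1)) (hmin (n + s))
    have h2 : α / √((n + s + 1 : ℕ) : ℝ) ≤ α / √((n + 1 : ℕ) : ℝ) := by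
      refine div_le_div_of_nonneg_left hα.le (Real.sqrt_pos.2 (by positivity))
        (Real.sqrt_le_sqrt (Nat.cast_le.2 (by omega)))
    have h3 := mul_le_mul_of_nonneg_right h2 hL
    have h4 := norm_sub_le_norm_sub_add_norm_sub (x (n + s + 1)) (x (n + s)) (x n)
    rw [← add_assoc]
    push_cast at *
    linarith

end Regret

/-- Here d n stands for the excess objective of iterate n, a i j for the excess loss of iterate i on
sample j, δ for the drift over s steps, and z for the centred noise. Shifting the diagonal sum by s
costs at most 2sB, which disappears after division by T. -/
lemma tendsto_average_of_shifted {d : ℕ → ℝ} {a : ℕ → ℕ → ℝ} {B : ℝ} (hd : ∀ n, 0 ≤ d n)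
    (haB : ∀ i j, |a i j| ≤ B) {q : ℕ → ℝ} (hq : Tendsto q atTop (𝓝 0))
    (hreg : ∀ T : ℕ, (∑ n ∈ Finset.range T, a n n) / T ≤ q T)
    (hstep : ∀ ε > 0, ∃ (s : ℕ) (δ z : ℕ → ℝ), Tendsto δ atTop (𝓝 0) ∧
      Tendsto (fun T : ℕ => (∑ n ∈ Finset.range T, z n) / T) atTop (𝓝 0) ∧
      ∀ n, a n (n + s) ≤ a (n + s) (n + s) + δ n ∧ d n ≤ a n (n + s) - z n + ε) :
    Tendsto (fun T : ℕ => (∑ n ∈ Finset.range T, d n) / T) atTop (𝓝 0) := by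
  refine tendsto_order.2 ⟨fun b hb => Eventually.of_forall fun T => hb.trans_le ?_,
    fun b hb => ?_⟩
  · exact div_nonneg (Finset.sum_nonneg fun n _ => hd n) (Nat.cast_nonneg T)
  obtain ⟨s, δ, z, hδ, hz, hn⟩ := hstep (b / 2) (half_pos hb)
  have hlim : Tendsto (fun T : ℕ => q T + 2 * s * B / T + (T : ℝ)⁻¹ * ∑ n ∈ Finset.range T, δ n
      - (∑ n ∈ Finset.range T, z n) / T + b / 2) atTop (𝓝 (0 + 0 + 0 - 0 + b / 2)) :=
    (((hq.add (tendsto_const_nhds.div_atTop tendsto_natCast_atTop_atTop)).add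
      hδ.cesaro).sub hz).add_const _
  have hlt : 0 + 0 + 0 - 0 + b / 2 < b := by linarith
  filter_upwards [hlim.eventually_lt_const hlt, eventually_gt_atTop 0] with T hT hT0
  refine lt_of_le_of_lt ?_ hT
  have hTR : (0 : ℝ) < T := by exact_mod_cast hT0
  have hshift : ∑ n ∈ Finset.range T, a (n + s) (n + s)
      ≤ ∑ n ∈ Finset.range T, a n n + 2 * s * B := by
    have e1 := Finset.sum_range_add (fun n => a n n) s T
    have e2 := Finset.sum_range_add (fun n => a n n) T s
    rw [add_comm s T, e2] at e1
    have h1 : -(s * B) ≤ ∑ n ∈ Finset.range s, a n n := by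
      have := Finset.card_nsmul_le_sum (Finset.range s) (fun n => a n n) (-B)
        fun n _ => (abs_le.1 (haB n n)).1
      rw [Finset.card_range, nsmul_eq_mul] at this
      linarith
    have h2 : ∑ n ∈ Finset.range s, a (T + n) (T + n) ≤ s * B := by
      have := Finset.sum_le_card_nsmul (Finset.range s) (fun n => a (T + n) (T + n)) B
        fun n _ => (abs_le.1 (haB _ _)).2
      rwa [Finset.card_range, nsmul_eq_mul] at this
    simp_rw [add_comm _ s]
    linarith
  have hsum : ∑ n ∈ Finset.range T, d n ≤ ∑ n ∈ Finset.range T, a n n + 2 * s * B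
      + ∑ n ∈ Finset.range T, δ n - ∑ n ∈ Finset.range T, z n + T * (b / 2) := by
    have := Finset.sum_le_sum fun n (_ : n ∈ Finset.range T) =>
      (hn n).2.trans (add_le_add_left (sub_le_sub_right (hn n).1 (z n)) (b / 2))
    rw [Finset.sum_add_distrib, Finset.sum_sub_distrib, Finset.sum_add_distrib,
      Finset.sum_const, Finset.card_range, nsmul_eq_mul] at this
    linarith
  calc (∑ n ∈ Finset.range T, d n) / T
      ≤ (∑ n ∈ Finset.range T, a n n + 2 * s * B
      + ∑ n ∈ Finset.range T, δ n - ∑ n ∈ Finset.range T, z n + T * (b / 2)) / T := by gcongr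
    _ = (∑ n ∈ Finset.range T, a n n) / T + 2 * s * B / T
      + (T : ℝ)⁻¹ * ∑ n ∈ Finset.range T, δ n
      - (∑ n ∈ Finset.range T, z n) / T + b / 2 := by field_simp
    _ ≤ _ := by linarith [hreg T]

lemma tendsto_mirror_descent_rate (α B L : ℝ) :
    Tendsto (fun T : ℕ => (1 / (α / √((T + 1 : ℕ) : ℝ)) * B
      + L ^ 2 / 2 * ∑ n ∈ Finset.range T, α / √((n + 1 : ℕ) : ℝ)) / T) atTop (𝓝 0) := by
  have h1 := ((tendsto_const_div_sqrt_succ α).cesaro).const_mul (L ^ 2 / 2)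
  have h2 : Tendsto (fun T : ℕ => √((T + 1 : ℕ) : ℝ) / T) atTop (𝓝 0) := by
    have h3 := tendsto_const_div_sqrt_succ 2
    refine squeeze_zero' (Eventually.of_forall fun T => by positivity) ?_ h3
    filter_upwards [eventually_ge_atTop 1] with T hT
    have hT' : (1 : ℝ) ≤ T := by exact_mod_cast hT
    rw [div_le_div_iff₀ (by linarith) (Real.sqrt_pos.2 (by positivity)),
      Real.mul_self_sqrt (by positivity)]
    push_cast; linarith
  have := (h2.const_mul (B / α)).add h1
  simp only [mul_zero, add_zero] at this
  refine this.congr fun T => ?_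
  rw [one_div_div, add_div]
  congr 1
  · ring
  · ring

/-- Excess losses, modified on a null set so as to be Lipschitz for every sample point. -/
lemma exists_lipschitz_excess {E Ξ : Type*} [NormedAddCommGroup E] [NormedSpace ℝ E]
    [FiniteDimensional ℝ E] [MeasurableSpace E] [BorelSpace E] [MeasurableSpace Ξ] {X : Set E}
    (hX : Bornology.IsBounded X) {F : E → Ξ → ℝ} (hF : ∀ x ∈ X, Measurable (F x)) {L : ℝ≥0}
    {μ : Measure Ξ} (hLip : ∀ᵐ z ∂μ, LipschitzOnWith L (fun x => F x z) X) {y : E} (hy : y ∈ X) :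
    ∃ h : X × Ξ → ℝ, Measurable h ∧ (∀ x x' z, |h (x, z) - h (x', z)| ≤ L * ‖(x : E) - x'‖) ∧
      (∀ p, |h p| ≤ L * Metric.diam X) ∧ ∀ᵐ z ∂μ, ∀ x : X, h (x, z) = F x z - F y z := by
  classical
  -- The exceptional set need not be measurable, so it is enlarged to a measurable null set.
  set N : Set Ξ := toMeasurable μ {z | ¬ LipschitzOnWith L (fun x => F x z) X} with hN
  have hNm : MeasurableSet N := measurableSet_toMeasurable _ _
  have hgood : ∀ z ∉ N, LipschitzOnWith L (fun x => F x z) X := fun z hz => by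
    by_contra hcon
    exact hz (subset_toMeasurable μ _ hcon)
  have hlip : ∀ z ∉ N, ∀ x ∈ X, ∀ x' ∈ X, |F x z - F x' z| ≤ L * ‖x - x'‖ :=
    fun z hz x hx x' hx' => by
      simpa [Real.dist_eq, dist_eq_norm] using (hgood z hz).dist_le_mul x hx x' hx'
  have hlip' : ∀ (x x' : X) (z : Ξ), |(if z ∈ N then 0 else F x z - F y z)
      - (if z ∈ N then 0 else F x' z - F y z)| ≤ L * ‖(x : E) - x'‖ := fun x x' z => by
    split_ifs with hz
    · simp only [sub_self, abs_zero]; positivity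
    · rw [sub_sub_sub_cancel_right]; exact hlip z hz x x.2 x' x'.2
  refine ⟨Function.uncurry fun (x : X) z => if z ∈ N then 0 else F x z - F y z, ?_, hlip', ?_, ?_⟩
  -- F is assumed measurable only in z for fixed x; joint measurability comes from continuity in x.
  · have : ProperSpace E := FiniteDimensional.proper_real E
    refine measurable_uncurry_of_continuous_of_measurable (fun z => ?_) fun x =>
      Measurable.ite hNm measurable_const ((hF x x.2).sub (hF y hy))
    refine (LipschitzWith.of_dist_le_mul (K := L) fun x x' => ?_).continuous
    rw [Real.dist_eq, Subtype.dist_eq, dist_eq_norm]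
    exact hlip' x x' z
  · rintro ⟨x, z⟩
    simp only [Function.uncurry_apply_pair]
    split_ifs with hz
    · simp only [abs_zero]
      exact mul_nonneg L.2 Metric.diam_nonneg
    · refine (hlip z hz x x.2 y hy).trans (mul_le_mul_of_nonneg_left ?_ L.2)
      rw [← dist_eq_norm]
      exact Metric.dist_le_diam_of_mem hX x.2 hy
  · have h0 : μ N = 0 := by rw [hN, measure_toMeasurable]; exact hLip
    filter_upwards [measure_eq_zero_iff_ae_notMem.1 h0] with z hz x
    simp [hz]

lemma convexOn_objective {E Ξ : Type*} [NormedAddCommGroup E] [NormedSpace ℝ E]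
    [MeasurableSpace Ξ] {X : Set E} (hX : Convex ℝ X) {ν : Measure Ξ} {F : E → Ξ → ℝ}
    (hF : ∀ z, ConvexOn ℝ X fun x => F x z) (hint : ∀ x ∈ X, Integrable (F x) ν) :
    ConvexOn ℝ X (objective F ν) := by
  refine ⟨hX, fun x hx y hy a b ha hb hab => ?_⟩
  unfold objective
  rw [smul_eq_mul, smul_eq_mul, ← integral_const_mul, ← integral_const_mul,
    ← integral_add ((hint x hx).const_mul a) ((hint y hy).const_mul b)]
  exact integral_mono (hint _ (hX hx hy ha hb hab))
    (((hint x hx).const_mul a).add ((hint y hy).const_mul b))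
    fun z => (hF z).2 hx hy ha hb hab

lemma average_mem {E Ω : Type*} [NormedAddCommGroup E] [NormedSpace ℝ E] {X : Set E}
    (hX : Convex ℝ X) {x : ℕ → Ω → E} {ω : Ω} (hx : ∀ n, x (n + 1) ω ∈ X) {T : ℕ} (hT : 1 ≤ T) :
    average x T ω ∈ X := by
  have hT' : (T : ℝ) ≠ 0 := by positivity
  rw [average_succ, Finset.smul_sum]
  refine hX.sum_mem (fun _ _ => by positivity) ?_ fun n _ => hx n
  simp [hT']

lemma apply_average_sub_le {E Ω : Type*} [NormedAddCommGroup E] [NormedSpace ℝ E] {X : Set E}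
    {f : E → ℝ} (hf : ConvexOn ℝ X f) {x : ℕ → Ω → E} {ω : Ω} (hx : ∀ n, x (n + 1) ω ∈ X) {T : ℕ}
    (hT : 1 ≤ T) (c : ℝ) :
    f (average x T ω) - c ≤ (∑ n ∈ Finset.range T, (f (x (n + 1) ω) - c)) / T := by
  have hT' : (T : ℝ) ≠ 0 := by positivity
  rw [average_succ, Finset.smul_sum]
  have h := hf.map_sum_le (t := Finset.range T) (w := fun _ => (T : ℝ)⁻¹)
    (p := fun n => x (n + 1) ω) (fun _ _ => by positivity) (by simp [hT']) fun n _ => hx n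
  simp only [smul_eq_mul] at h
  rw [← Finset.mul_sum] at h
  rw [Finset.sum_sub_distrib, Finset.sum_const, Finset.card_range, nsmul_eq_mul, sub_div,
    mul_div_cancel_left₀ _ hT', div_eq_inv_mul]
  linarith

end ErgodicMD

/-! ### Convergence of ergodic mirror descent -/

open ErgodicMD

theorem corollary8
    {E : Type*} [NormedAddCommGroup E] [NormedSpace ℝ E] [FiniteDimensional ℝ E]
    [MeasurableSpace E] [BorelSpace E]
    {Ω Ξ : Type*} [MeasurableSpace Ω] [MeasurableSpace Ξ]
    (P : Measure Ω) [IsProbabilityMeasure P]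
    -- the compact convex domain and the prox-function
    (X : Set E) (hXcompact : IsCompact X) (hXconvex : Convex ℝ X)
    (ψ : E → ℝ) (hψdiff : DifferentiableOn ℝ ψ X) (hψconvex : StrongConvexOn X 1 ψ)
    (R : ℝ) (hR : ∀ x ∈ X, ∀ y ∈ X, ErgodicMD.bregman X ψ x y ≤ (1 / 2) * R ^ 2)
    -- the convex functions, with the objective well defined, and the measurable subgradients
    (ν : Measure Ξ) [IsProbabilityMeasure ν]
    (F : E → Ξ → ℝ) (hFconvex : ∀ z, ConvexOn ℝ X (fun x => F x z))
    (hFmeas : ∀ x ∈ X, Measurable (F x)) (hFint : ∀ x ∈ X, Integrable (F x) ν)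
    (G : E → Ξ → StrongDual ℝ E) (hGmeas : Measurable (fun p : X × Ξ => G p.1 p.2))
    (hGsub : ∀ z, ∀ x ∈ X, ErgodicMD.IsSubgradientOn X (fun y => F y z) x (G x z))
    -- the samples, uniformly mixing
    (ξ : ℕ → Ω → Ξ) (hξmeas : ∀ t, 1 ≤ t → Measurable (ξ t))
    (hmix : ErgodicMD.UniformlyMixing P ξ ν)
    -- Lipschitz continuity, for almost every point under the limit law and under the laws of the samples
    (L : ℝ≥0)
    (hLipLimit : ∀ᵐ z ∂ν, LipschitzOnWith L (fun x => F x z) X ∧ ∀ x ∈ X, ‖G x z‖ ≤ L)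
    (hLipSample : ∀ t, 1 ≤ t → ∀ᵐ z ∂(P.map (ξ t)),
      LipschitzOnWith L (fun x => F x z) X ∧ ∀ x ∈ X, ‖G x z‖ ≤ L)
    -- the iterates with stepsizes `α / √t`
    (α : ℝ) (hα : 0 < α) (x₁ : E) (hx₁ : x₁ ∈ X) (x : ℕ → Ω → E)
    (hx : ErgodicMD.IsEMD X ψ G ξ (fun t => α / √(t : ℝ)) x₁ x)
    -- a minimizer of the objective
    (xstar : E) (hxstar : xstar ∈ X) (hmin : IsMinOn (ErgodicMD.objective F ν) X xstar) :
    (∀ T, 1 ≤ T →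
      Integrable (fun ω => ErgodicMD.objective F ν (ErgodicMD.average x T ω)) P) ∧
    Tendsto (fun T => ∫ ω, ErgodicMD.objective F ν (ErgodicMD.average x T ω) ∂P) atTop
      (𝓝 (ErgodicMD.objective F ν xstar)) ∧
    ∀ᵐ ω ∂P, Tendsto (fun T => ErgodicMD.objective F ν (ErgodicMD.average x T ω)) atTop
      (𝓝 (ErgodicMD.objective F ν xstar)) := by
  have hXb := hXcompact.isBounded
  have hmem : ∀ n ω, x (n + 1) ω ∈ X := fun n ω => hx.mem_of_one_le hx₁ (by omega) ω
  set f := objective F ν with hf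
  -- Dominating the limit law and all sample laws by one measure lets a single modification h of the
  -- excess loss serve for all of them.
  set μ : Measure Ξ := ν + Measure.sum fun t => P.map (ξ (t + 1)) with hμ
  have hLip : ∀ᵐ z ∂μ, LipschitzOnWith L (fun x => F x z) X ∧ ∀ x ∈ X, ‖G x z‖ ≤ L := by
    rw [hμ, ae_add_measure_iff, Measure.ae_sum_iff]
    exact ⟨hLipLimit, fun t => hLipSample (t + 1) (by omega)⟩
  obtain ⟨h, hhm, hhlip, hhB, hhF⟩ := exists_lipschitz_excess hXb hFmeas
    (hLip.mono fun z hz => hz.1) hxstar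
  set C : ℝ := L * Metric.diam X with hC
  have hhF' := hhF
  rw [hμ, ae_add_measure_iff, Measure.ae_sum_iff] at hhF'
  have hfh : ∀ y : X, f y - f xstar = ∫ z, h (y, z) ∂ν := fun y => by
    rw [hf, objective, objective, ← integral_sub (hFint y y.2) (hFint xstar hxstar)]
    exact integral_congr_ae (hhF'.1.mono fun z hz => (hz y).symm)
  have hfC : ∀ y : X, |f y - f xstar| ≤ C := fun y => by
    rw [hfh]
    simpa using norm_integral_le_of_norm_le_const (μ := ν) (f := fun z => h (y, z))
      (ae_of_all _ fun z => hhB (y, z))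
  have hhi : ∀ y : X, Integrable (fun z => h (y, z)) ν := fun y =>
    Integrable.of_bound (hhm.comp measurable_prodMk_left).aestronglyMeasurable C
      (ae_of_all _ fun z => hhB (y, z))
  have hfcont : Continuous fun y : X => f y := by
    refine (LipschitzWith.of_dist_le_mul (K := L) fun y y' => ?_).continuous
    rw [Real.dist_eq, Subtype.dist_eq, dist_eq_norm, ← sub_sub_sub_cancel_right _ _ (f xstar),
      hfh, hfh, ← integral_sub (hhi y) (hhi y')]
    simpa using norm_integral_le_of_norm_le_const (μ := ν)
      (f := fun z => h (y, z) - h (y', z)) (ae_of_all _ fun z => hhlip y y' z)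
  have hfconv := convexOn_objective hXconvex hFconvex hFint
  have hαpos : ∀ t : ℕ, 1 ≤ t → 0 < α / √(t : ℝ) := fun t ht =>
    div_pos hα (Real.sqrt_pos.2 (by exact_mod_cast ht))
  have hxm := hx.measurable_succ hψdiff hψconvex hGmeas hαpos hx₁
  set W : ℕ → Ω → X := fun n ω => ⟨x (n + 1) ω, hmem n ω⟩ with hWdef
  have hW : ∀ n, Measurable[pastSigma ξ n] (W n) := fun n =>
    @Measurable.subtype_mk Ω E (pastSigma ξ n) _ _ _ (hxm n) (hmem n)
  have hxm' : ∀ n, Measurable (x (n + 1)) := fun n => (hxm n).mono (pastSigma_le hξmeas n) le_rfl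
  have havg : ∀ T, 1 ≤ T → Measurable fun ω => f (average x T ω) := fun T hT => by
    have h1 : Measurable fun ω => average x T ω := by
      simp_rw [average_succ]
      exact (Finset.measurable_fun_sum _ fun n _ => hxm' n).const_smul _
    exact hfcont.measurable.comp (h1.subtype_mk (h := fun ω =>
      average_mem hXconvex (fun n => hmem n ω) hT))
  have havgB : ∀ T, 1 ≤ T → ∀ ω, ‖f (average x T ω)‖ ≤ C + |f xstar| := fun T hT ω => by
    have h1 := hfC ⟨_, average_mem hXconvex (fun n => hmem n ω) hT⟩
    have h2 := abs_add_le (f (average x T ω) - f xstar) (f xstar)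
    rw [sub_add_cancel] at h2
    rw [Real.norm_eq_abs]
    linarith
  obtain ⟨κ, hκ, τ, _, hτ⟩ := hmix
  have hmixing : ∀ᵐ ω ∂P, ∀ ε, 0 < ε → 1 ≤ τ ε ∧
      ∀ n, tvDist (κ n (n + τ ε) ω) ν ≤ ε := by
    filter_upwards [hτ] with ω hω ε hε
    exact ⟨(dist_le_of_mixingTime_le (hω ε hε 0).1).1, fun n =>
      (dist_le_of_mixingTime_le (hω ε hε n).1).2 _ le_rfl⟩
  have hτ1 : ∀ ε, 0 < ε → 1 ≤ τ ε := by
    obtain ⟨ω, hω⟩ := hmixing.exists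
    exact fun ε hε => (hω ε hε).1
  -- Only the levels 1/(k+1) are used, so that one almost sure event covers every accuracy.
  have hslln : ∀ᵐ ω ∂P, ∀ k : ℕ, Tendsto (fun T : ℕ => (∑ n ∈ Finset.range T,
      (h (W n ω, ξ (n + τ (1 / ((k : ℝ) + 1))) ω)
        - ∫ z, h (W n ω, z) ∂(κ n (n + τ (1 / ((k : ℝ) + 1))) ω))) / T) atTop (𝓝 0) := by
    refine ae_all_iff.2 fun k => ?_
    have hk1 := hτ1 (1 / ((k : ℝ) + 1)) (by positivity)
    exact ae_tendsto_average_centred hξmeas hk1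
      (fun n => hκ n (n + τ (1 / ((k : ℝ) + 1))) (by omega)) hW hhm hhB
  have hsample : ∀ᵐ ω ∂P, ∀ t : ℕ, ∀ y ∈ X, ‖G y (ξ (t + 1) ω)‖ ≤ L := by
    refine ae_all_iff.2 fun t => ?_
    exact ae_of_ae_map (hξmeas (t + 1) (by omega)).aemeasurable
      ((hLipSample (t + 1) (by omega)).mono fun z hz => hz.2)
  have hsampleF : ∀ᵐ ω ∂P, ∀ t : ℕ, ∀ y : X,
      h (y, ξ (t + 1) ω) = F y (ξ (t + 1) ω) - F xstar (ξ (t + 1) ω) := by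
    refine ae_all_iff.2 fun t => ?_
    exact ae_of_ae_map (hξmeas (t + 1) (by omega)).aemeasurable (hhF'.2 t)
  have hconv : ∀ᵐ ω ∂P, Tendsto (fun T => f (average x T ω)) atTop (𝓝 (f xstar)) := by
    filter_upwards [hmixing, hslln, hsample, hsampleF] with ω hω1 hω2 hω3 hω4
    have hg : ∀ n, ‖G (x (n + 1) ω) (ξ (n + 1) ω)‖ ≤ L := fun n => hω3 n _ (hmem n ω)
    have hargmin := fun n : ℕ => hx.argmin (n + 1) (by omega) ω
    have hd : Tendsto (fun T : ℕ => (∑ n ∈ Finset.range T, (f (x (n + 1) ω) - f xstar)) / T)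
        atTop (𝓝 0) := by
      refine tendsto_average_of_shifted (a := fun i j => h (W i ω, ξ (j + 1) ω)) (B := C)
        (fun n => sub_nonneg.2 (hmin (hmem n ω))) (fun i j => hhB _)
        (tendsto_mirror_descent_rate α (1 / 2 * R ^ 2) L) (fun T => ?_) fun ε hε => ?_
      · refine div_le_div_of_nonneg_right ((Finset.sum_le_sum fun n _ => ?_).trans
          (mirror_descent_regret hψdiff hψconvex hR hα (x := fun n => x (n + 1) ω)
            (fun n => hmem n ω) hg hargmin hxstar T)) (Nat.cast_nonneg T)
        have h1 := hGsub (ξ (n + 1) ω) _ (hmem n ω) xstar hxstar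
        rw [← neg_sub, map_neg] at h1
        rw [hω4 n (W n ω)]
        simp only [hWdef]
        linarith
      · have hC0 : 0 ≤ C := mul_nonneg L.2 Metric.diam_nonneg
        -- Dividing by C + 1 rather than C allows C = 0.
        obtain ⟨k, hk⟩ := exists_nat_one_div_lt (div_pos hε (by linarith : 0 < C + 1))
        have hη : (0 : ℝ) < 1 / ((k : ℝ) + 1) := by positivity
        have hCε : C * (1 / ((k : ℝ) + 1)) ≤ ε := by
          rw [lt_div_iff₀ (by linarith)] at hk
          nlinarith
        -- Iterate n+1 already lags one index behind its past, so a sample gap of s+1 shifts the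
        -- iterates by only s.
        obtain ⟨s, hs⟩ : ∃ s, τ (1 / ((k : ℝ) + 1)) = s + 1 :=
          ⟨_, (Nat.sub_add_cancel (hτ1 _ hη)).symm⟩
        have hω2k := hω2 k
        have hω1k := (hω1 _ hη).2
        rw [hs] at hω2k hω1k
        refine ⟨s, fun n => L * (s * L * (α / √((n + 1 : ℕ) : ℝ))), _, ?_, hω2k,
          fun n => ⟨?_, ?_⟩⟩
        · simpa using ((tendsto_const_div_sqrt_succ α).const_mul (s * L : ℝ)).const_mul (L : ℝ)
        · have h1 := mirror_descent_stable hψdiff hψconvex hα (x := fun n => x (n + 1) ω)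
            (fun n => hmem n ω) hg hargmin n s
          have h2 := (le_abs_self _).trans (hhlip (W n ω) (W (n + s) ω) (ξ (n + s + 1) ω))
          rw [norm_sub_rev] at h2
          have h3 := mul_le_mul_of_nonneg_left h1 L.2
          simp only [NNReal.val_eq_coe] at h3
          linarith
        · have hprob := (hκ n (n + (s + 1)) (by omega)).prob ω
          have h1 := abs_integral_sub_le_mul_tvDist (κ n (n + (s + 1)) ω) ν
            (h := fun z => h (W n ω, z)) (hhm.comp measurable_prodMk_left) fun z => hhB _
          have h2 := (abs_le.1 (h1.trans (mul_le_mul_of_nonneg_left (hω1k n) hC0))).1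
          rw [← hfh (W n ω)] at h2
          simp only [hWdef, ← add_assoc] at h2 ⊢
          linarith
    have h0 : Tendsto (fun T => f (average x T ω) - f xstar) atTop (𝓝 0) := by
      refine squeeze_zero' ?_ ?_ hd
      · filter_upwards [eventually_ge_atTop 1] with T hT
        exact sub_nonneg.2 (hmin (average_mem hXconvex (fun n => hmem n ω) hT))
      · filter_upwards [eventually_ge_atTop 1] with T hT
        exact apply_average_sub_le hfconv (fun n => hmem n ω) hT (f xstar)
    simpa using h0.add_const (f xstar)
  refine ⟨fun T hT => Integrable.of_bound (havg T hT).aestronglyMeasurable _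
    (ae_of_all _ (havgB T hT)), ?_, hconv⟩
  -- The bounds hold from T = 1 on: for T = 0 the average is 0, which need not lie in X.
  have hdom := tendsto_integral_filter_of_dominated_convergence (μ := P) (l := atTop)
    (F := fun T ω => f (average x T ω)) (f := fun _ => f xstar) (fun _ => C + |f xstar|)
    ((eventually_ge_atTop 1).mono fun T hT => (havg T hT).aestronglyMeasurable)
    ((eventually_ge_atTop 1).mono fun T hT => ae_of_all _ (havgB T hT))
    (integrable_const _) hconv
  simpa using hdom
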